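/- Let $K$ be a field of characteristic zero, $n\in\mathbb N_0$, and $q_1,\dots,q_n\in K\setminus\{0\}$. Let $Q_n$ be the $n$th $\underline q$-Weyl algebra, i.e. the $K$-algebra generated by $x_1,\dots,x_n,\partial_1,\dots,\partial_n$ with relations $x_ix_j=x_jx_i$, $\partial_i\partial_j=\partial_j\partial_i$, $\partial_ix_j=x_j\partial_i$ for $i\ne j$, and $\partial_ix_i=q_ix_i\partial_i+1$; for $q_1=\dots=q_n=1$ it is the $n$th Weyl algebra $A_n$. Put $\theta_i=x_i\partial_i$ and $K[\underline\theta]=K[\theta_1,\dots,\theta_n]$. For $z\in\mathbb Z^n$ let $Q_n^{(z)}$ be the $K$-span of the monomials $X^aD^b=x_1^{a_1}\cdots x_n^{a_n}\partial_1^{b_1}\cdots\partial_n^{b_n}$ with $a,b\in\mathbb N_0^n$, $b-a=z$, and put $e_i=\max(-z_i,0)$, $w_i=\max(z_i,0)$. A *nontrivial factorization* of $p\in Q_n$ is a tuple $(c,f_1,\dots,f_m)$ with $m\ge 0$, $c\in K\setminus\{0\}$, $f_i\in Q_n\setminus K$ and $p=c\,f_1\cdots f_m$. (The factors may be normalized to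 be monic, but need not be.) Consider the following operations on such tuples. (i) *Swapping*: replacing two adjacent factors by means of one of the commutation rules, read in either direction: $f(\underline\theta)\cdot g(\underline\theta)=g(\underline\theta)\cdot f(\underline\theta)$; $f(\underline\theta)\cdot x_i=x_i\cdot f(\dots,q_i\theta_i+1,\dots)$; $f(\underline\theta)\cdot\partial_i=\partial_i\cdot f(\dots,(\theta_i-1)/q_i,\dots)$; $x_i\cdot x_j=x_j\cdot x_i$; $\partial_i\cdot\partial_j=\partial_j\cdot\partial_i$; $x_i\cdot\partial_j=\partial_j\cdot x_i$ for $i\neq j$. (ii) *Rewriting*: replacing a factor $\theta_i$ by the two factors $x_i,\partial_i$, or a factor $\theta_i+\frac1{q_i}$ by the two factors $\partial_i,x_i$ and at the same time $c$ by $c/q_i$ (note $\partial_ix_i=q_i(\theta_i+\frac1{q_i})$; in $A_n$ this factor is $\theta_i+1=\partial_ix_i$). Moreover, nonzero constants may be moved freely between $c$ and the factors. A tuple is *derivable* from another one if it arises from it by finitely many of these operations. **Lemma.** Let $z\in\mathbb Z^n$ and $p\in Q_n^{(z)}$, and suppose that $$p=c_0\cdot Q(\underline\theta)\cdot T(\underline\theta)\cdot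 X^eD^w,\qquad T(\underline\theta)=\prod_{i=1}^n\theta_i^{t_i}\Bigl(\theta_i+\frac1{q_i}\Bigr)^{s_i},\qquad t_i,s_i\in\mathbb N_0,$$ where $c_0\in K\setminus\{0\}$ and $Q(\underline\theta)$ is a finite product of polynomials that are irreducible both in $K[\underline\theta]$ and in $Q_n$. Let $F_0$ be the tuple consisting of $c_0$, the given irreducible factors of $Q(\underline\theta)$, the factors $\theta_i$ and $\theta_i+\frac1{q_i}$ of $T(\underline\theta)$ with their multiplicities, and the single variables in $X^eD^w$, in this order. 1. Every nontrivial factorization of $p$ all of whose factors are irreducible in $Q_n$ is derivable from $F_0$. 2. For every nontrivial factorization $(c,f_1,\dots,f_m)$ of $p$ (with possibly reducible factors) there is a tuple $(c,g_1,\dots,g_k)$ derivable from $F_0$ such that $f_1,\dots,f_m$ are the products of consecutive blocks of $g_1,\dots,g_k$. -/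

import Mathlib

noncomputable section

/-- The defining relations of the `n`-th `q`-Weyl algebra; `Sum.inl i` stands for `x_i` and
`Sum.inr i` for `∂_i`. -/
inductive QWeylRel {K : Type*} [Field K] {n : ℕ} (q : Fin n → Kˣ) :
    FreeAlgebra K (Fin n ⊕ Fin n) → FreeAlgebra K (Fin n ⊕ Fin n) → Prop
  | x_x (i j : Fin n) : QWeylRel q
      (FreeAlgebra.ι K (Sum.inl i) * FreeAlgebra.ι K (Sum.inl j))
      (FreeAlgebra.ι K (Sum.inl j) * FreeAlgebra.ι K (Sum.inl i))
  | d_d (i j : Fin n) : QWeylRel q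
      (FreeAlgebra.ι K (Sum.inr i) * FreeAlgebra.ι K (Sum.inr j))
      (FreeAlgebra.ι K (Sum.inr j) * FreeAlgebra.ι K (Sum.inr i))
  | d_x_of_ne (i j : Fin n) (h : i ≠ j) : QWeylRel q
      (FreeAlgebra.ι K (Sum.inr i) * FreeAlgebra.ι K (Sum.inl j))
      (FreeAlgebra.ι K (Sum.inl j) * FreeAlgebra.ι K (Sum.inr i))
  | d_x_self (i : Fin n) : QWeylRel q
      (FreeAlgebra.ι K (Sum.inr i) * FreeAlgebra.ι K (Sum.inl i))
      ((q i : K) • (FreeAlgebra.ι K (Sum.inl i) * FreeAlgebra.ι K (Sum.inr i)) + 1)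

/-- The `n`-th `q`-Weyl algebra `Q_n`, given by generators and relations.
For `q = 1` this is the `n`-th Weyl algebra `A_n`. -/
abbrev QWeyl {K : Type*} [Field K] {n : ℕ} (q : Fin n → Kˣ) : Type _ := RingQuot (QWeylRel q)

namespace QWeyl

variable {K : Type*} [Field K] {n : ℕ} (q : Fin n → Kˣ)

/-- The generator `x_i`. -/
def x (i : Fin n) : QWeyl q :=
  RingQuot.mkAlgHom K (QWeylRel q) (FreeAlgebra.ι K (Sum.inl i))

/-- The generator `∂_i`. -/
def d (i : Fin n) : QWeyl q :=
  RingQuot.mkAlgHom K (QWeylRel q) (FreeAlgebra.ι K (Sum.inr i))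

/-- The monomial `X^a D^b = x_1^{a_1} ⋯ x_n^{a_n} ∂_1^{b_1} ⋯ ∂_n^{b_n}`. -/
def monomial (a b : Fin n → ℕ) : QWeyl q :=
  (List.ofFn fun i => x q i ^ a i).prod * (List.ofFn fun i => d q i ^ b i).prod

/-- The graded part `Q_n^{(z)}`, spanned by the monomials `X^a D^b` with `b - a = z`. -/
def gradedPart (z : Fin n → ℤ) : Submodule K (QWeyl q) :=
  Submodule.span K
    {m | ∃ a b : Fin n → ℕ, (∀ i, (b i : ℤ) - (a i : ℤ) = z i) ∧ m = monomial q a b}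

/-- The Euler operator `θ_i = x_i ∂_i`. -/
def theta (i : Fin n) : QWeyl q := x q i * d q i

/-- The value `f(θ_1, …, θ_n)` of a commutative polynomial `f`, as an element of `Q_n`. -/
def evalTheta (f : MvPolynomial (Fin n) K) : QWeyl q :=
  ∑ m ∈ f.support, f.coeff m • (List.ofFn fun i => theta q i ^ m i).prod

/-- The substitution `θ_i ↦ q_i θ_i + 1`, for which `f(θ) x_i = x_i (shiftX i f)(θ)`. -/
def shiftX (i : Fin n) : MvPolynomial (Fin n) K →ₐ[K] MvPolynomial (Fin n) K :=
  MvPolynomial.aeval (Function.update MvPolynomial.X i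
    (MvPolynomial.C (q i : K) * MvPolynomial.X i + 1))

/-- The substitution `θ_i ↦ (θ_i - 1) / q_i`, for which `f(θ) ∂_i = ∂_i (shiftD i f)(θ)`. -/
def shiftD (i : Fin n) : MvPolynomial (Fin n) K →ₐ[K] MvPolynomial (Fin n) K :=
  MvPolynomial.aeval (Function.update MvPolynomial.X i
    (MvPolynomial.C (q i : K)⁻¹ * (MvPolynomial.X i - 1)))

/-- `Commutation q a b b' a'`: the product `a * b` of two adjacent factors may be replaced by
`b' * a'` according to one of the commutation rules between polynomials in `θ_1, …, θ_n` and
generators, or between two generators that commute. -/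
inductive Commutation : QWeyl q → QWeyl q → QWeyl q → QWeyl q → Prop
  | theta_theta (f g : MvPolynomial (Fin n) K) :
      Commutation (evalTheta q f) (evalTheta q g) (evalTheta q g) (evalTheta q f)
  | theta_x (f : MvPolynomial (Fin n) K) (i : Fin n) :
      Commutation (evalTheta q f) (x q i) (x q i) (evalTheta q (shiftX q i f))
  | theta_d (f : MvPolynomial (Fin n) K) (i : Fin n) :
      Commutation (evalTheta q f) (d q i) (d q i) (evalTheta q (shiftD q i f))
  | x_x (i j : Fin n) : Commutation (x q i) (x q j) (x q j) (x q i)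
  | d_d (i j : Fin n) : Commutation (d q i) (d q j) (d q j) (d q i)
  | x_d (i j : Fin n) (h : i ≠ j) : Commutation (x q i) (d q j) (d q j) (x q i)

/-- One operation on a factorization, which is stored as a pair `(c, [f_1, …, f_m])` and stands
for `c • f_1 ⋯ f_m`:
* swapping two adjacent factors by a commutation rule, read in either direction;
* rewriting a factor `θ_i` as the two factors `x_i, ∂_i`;
* rewriting a factor `θ_i + 1 / q_i` as the two factors `∂_i, x_i`
  (note `∂_i x_i = q_i (θ_i + 1 / q_i)`);
* renormalizing, that is, moving a nonzero constant between `c` and a factor. -/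
inductive Step : K × List (QWeyl q) → K × List (QWeyl q) → Prop
  | swap (c : K) (u v : List (QWeyl q)) (a b b' a' : QWeyl q) (h : Commutation q a b b' a') :
      Step (c, u ++ [a, b] ++ v) (c, u ++ [b', a'] ++ v)
  | swap_symm (c : K) (u v : List (QWeyl q)) (a b b' a' : QWeyl q)
      (h : Commutation q a b b' a') :
      Step (c, u ++ [b', a'] ++ v) (c, u ++ [a, b] ++ v)
  | rewrite_theta (c : K) (u v : List (QWeyl q)) (i : Fin n) :
      Step (c, u ++ [theta q i] ++ v) (c, u ++ [x q i, d q i] ++ v)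
  | rewrite_theta_add (c : K) (u v : List (QWeyl q)) (i : Fin n) :
      Step (c, u ++ [theta q i + algebraMap K (QWeyl q) (q i : K)⁻¹] ++ v)
        (c * (q i : K)⁻¹, u ++ [d q i, x q i] ++ v)
  | renormalize (c a : K) (ha : a ≠ 0) (u v : List (QWeyl q)) (f : QWeyl q) :
      Step (c * a, u ++ [f] ++ v) (c, u ++ [a • f] ++ v)

/-- `Derivable q F G`: the factorization `G` arises from `F` by finitely many operations. -/
def Derivable (F G : K × List (QWeyl q)) : Prop := Relation.ReflTransGen (Step q) F G

/-- `(c, [f_1, …, f_m])` is a nontrivial factorization of `p`: `c` is a nonzero constant, no `f_i`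
is a constant, and `p = c • f_1 ⋯ f_m`. The factors may have any normalization, in particular they
may all be monic (a monic element is a constant only if it is `1`). -/
def IsNontrivialFactorization (p : QWeyl q) (F : K × List (QWeyl q)) : Prop :=
  F.1 ≠ 0 ∧ (∀ f ∈ F.2, f ∉ Set.range (algebraMap K (QWeyl q))) ∧ p = F.1 • F.2.prod

/-- The factors of `T(θ) = ∏ θ_i^{t_i} (θ_i + 1 / q_i)^{s_i}`. -/
def factorsT (t s : Fin n → ℕ) : List (QWeyl q) :=
  (List.ofFn fun i => List.replicate (t i) (theta q i) ++
    List.replicate (s i) (theta q i + algebraMap K (QWeyl q) (q i : K)⁻¹)).flatten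

/-- The single variables in `X^{e(z)} D^{w(z)}`, where `e(z)_i = max (-z_i) 0` and
`w(z)_i = max z_i 0`. -/
def factorsXD (z : Fin n → ℤ) : List (QWeyl q) :=
  (List.ofFn fun i => List.replicate (-z i).toNat (x q i)).flatten ++
    (List.ofFn fun i => List.replicate (z i).toNat (d q i)).flatten

end QWeyl

end

/-! Mapping `x_i` to the `i`-th generator `g_i` of `ℤ^n` and `∂_i` to `g_i⁻¹ θ_i` sends `Q_n` to the
skew group ring of `ℤ^n` over `K[θ]`. Since `ℤ^n` has two unique products and `K[θ]` is a domain,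
factors of a monomial in that ring are monomials (`exists_single_of_mul_eq_single`). Hence all
factors of `p` are homogeneous, that is, of the form `g(θ) X^e D^w`, and splitting `g` into
irreducible polynomials turns every factorization into a tuple of letters.

Rewriting only splits `θ_i` and `θ_i + 1/q_i`, so derivations run from a normal form `P(θ) X^e D^w`
towards other tuples. Every tuple of letters is reached from some normal form
(`exists_derivable_normalForm`). Two normal forms with the same value have the same degree and
associated polynomial parts, so unique factorization in `K[θ]` makes them derivable from each other
(`derivable_of_smul_prod_eq`). As `F_0` is a normal form, it yields every tuple of letters with
value `p`. Grouping letters into blocks gives the second claim. Letters are not units, so an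
irreducible factor is a single letter up to a constant, which gives the first. -/

noncomputable section

namespace QWeyl

variable {K : Type*} [Field K] {n : ℕ} (q : Fin n → Kˣ)

/-! ### Relations between `x_i`, `∂_i` and `θ_i`. -/

section Relations

lemma x_mul_x (i j : Fin n) : x q i * x q j = x q j * x q i := by
  simpa [x] using RingQuot.mkAlgHom_rel K (QWeylRel.x_x (q := q) i j)

lemma d_mul_d (i j : Fin n) : d q i * d q j = d q j * d q i := by
  simpa [d] using RingQuot.mkAlgHom_rel K (QWeylRel.d_d (q := q) i j)

lemma d_mul_x_of_ne {i j : Fin n} (h : i ≠ j) : d q i * x q j = x q j * d q i := by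
  simpa [x, d] using RingQuot.mkAlgHom_rel K (QWeylRel.d_x_of_ne (q := q) i j h)

lemma d_mul_x_self (i : Fin n) : d q i * x q i = (q i : K) • theta q i + 1 := by
  simpa [x, d, theta] using RingQuot.mkAlgHom_rel K (QWeylRel.d_x_self (q := q) i)

lemma theta_mul_x_self (i : Fin n) : theta q i * x q i = x q i * ((q i : K) • theta q i + 1) := by
  rw [theta, mul_assoc, d_mul_x_self, theta]

lemma theta_mul_x_of_ne {i j : Fin n} (h : i ≠ j) : theta q i * x q j = x q j * theta q i := by
  rw [theta, mul_assoc, d_mul_x_of_ne q h, ← mul_assoc, x_mul_x, mul_assoc]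

lemma theta_mul_d_of_ne {i j : Fin n} (h : i ≠ j) : theta q i * d q j = d q j * theta q i := by
  rw [theta, mul_assoc, d_mul_d, ← mul_assoc, ← d_mul_x_of_ne q h.symm, mul_assoc]

lemma d_mul_theta_self (i : Fin n) : d q i * theta q i = (q i : K) • (theta q i * d q i) + d q i := by
  rw [theta, ← mul_assoc, d_mul_x_self, theta, add_mul, smul_mul_assoc, one_mul]

lemma theta_mul_d_self (i : Fin n) :
    theta q i * d q i = d q i * ((q i : K)⁻¹ • (theta q i - 1)) := by
  rw [mul_smul_comm, mul_sub, d_mul_theta_self, mul_one, add_sub_cancel_right, smul_smul,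
    inv_mul_cancel₀ (q i).ne_zero, one_smul]

lemma theta_mul_theta (i j : Fin n) : theta q i * theta q j = theta q j * theta q i := by
  rcases eq_or_ne i j with rfl | h
  · rfl
  · rw [theta.eq_def q j, ← mul_assoc, theta_mul_x_of_ne q h, mul_assoc, theta_mul_d_of_ne q h,
      mul_assoc]

lemma d_mul_x_eq (i : Fin n) :
    d q i * x q i = (q i : K) • (theta q i + algebraMap K (QWeyl q) (q i : K)⁻¹) := by
  rw [d_mul_x_self, smul_add, Algebra.algebraMap_eq_smul_one, smul_smul,
    mul_inv_cancel₀ (q i).ne_zero, one_smul]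

end Relations

/-! ### The substitutions on `K[θ]`. -/

section Shift

@[simp]
lemma shiftX_C (i : Fin n) (a : K) : shiftX q i (MvPolynomial.C a) = MvPolynomial.C a := by
  rw [← MvPolynomial.algebraMap_eq, AlgHom.commutes]

@[simp]
lemma shiftD_C (i : Fin n) (a : K) : shiftD q i (MvPolynomial.C a) = MvPolynomial.C a := by
  rw [← MvPolynomial.algebraMap_eq, AlgHom.commutes]

lemma shiftX_X_self (i : Fin n) : shiftX q i (MvPolynomial.X i) =
    MvPolynomial.C (q i : K) * MvPolynomial.X i + 1 := by
  rw [shiftX, MvPolynomial.aeval_X, Function.update_self]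

lemma shiftD_X_self (i : Fin n) : shiftD q i (MvPolynomial.X i) =
    MvPolynomial.C (q i : K)⁻¹ * (MvPolynomial.X i - 1) := by
  rw [shiftD, MvPolynomial.aeval_X, Function.update_self]

lemma shiftX_X_of_ne {i j : Fin n} (h : j ≠ i) :
    shiftX q i (MvPolynomial.X j) = MvPolynomial.X j := by
  rw [shiftX, MvPolynomial.aeval_X, Function.update_of_ne h]

lemma shiftD_X_of_ne {i j : Fin n} (h : j ≠ i) :
    shiftD q i (MvPolynomial.X j) = MvPolynomial.X j := by
  rw [shiftD, MvPolynomial.aeval_X, Function.update_of_ne h]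

lemma C_mul_C_inv (i : Fin n) : (MvPolynomial.C (q i : K) * MvPolynomial.C (q i : K)⁻¹ :
    MvPolynomial (Fin n) K) = 1 := by
  rw [← map_mul, mul_inv_cancel₀ (q i).ne_zero, map_one]

end Shift

/-! ### Evaluation of polynomials at `θ`. -/

section EvalTheta

open scoped IsMulCommutative in
/-- The evaluation `f ↦ f(θ_1, …, θ_n)` is a homomorphism of algebras. -/
lemma exists_algHom_eq_evalTheta :
    ∃ ψ : MvPolynomial (Fin n) K →ₐ[K] QWeyl q,
      (∀ f, ψ f = evalTheta q f) ∧ ∀ i, ψ (MvPolynomial.X i) = theta q i := by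
  have hcomm : ∀ a ∈ Set.range (theta q), ∀ b ∈ Set.range (theta q), a * b = b * a := by
    rintro _ ⟨i, rfl⟩ _ ⟨j, rfl⟩
    exact theta_mul_theta q i j
  -- `MvPolynomial.aeval` needs a commutative target: the subalgebra generated by the `θ_i`.
  have := Algebra.isMulCommutative_adjoin K hcomm
  let t : Fin n → Algebra.adjoin K (Set.range (theta q)) := fun i =>
    ⟨theta q i, Algebra.subset_adjoin ⟨i, rfl⟩⟩
  refine ⟨(Subalgebra.val _).comp (MvPolynomial.aeval t), fun f => ?_, fun i => by
    rw [AlgHom.comp_apply, MvPolynomial.aeval_X]; rfl⟩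
  rw [AlgHom.comp_apply, MvPolynomial.aeval_def, MvPolynomial.eval₂_eq', map_sum, evalTheta]
  refine Finset.sum_congr rfl fun m _ => ?_
  rw [map_mul, AlgHom.commutes, ← Algebra.smul_def, ← List.prod_ofFn, map_list_prod, List.map_ofFn]
  rfl

/-- The evaluation `f ↦ f(θ_1, …, θ_n)` as a homomorphism of algebras. -/
def evalHom : MvPolynomial (Fin n) K →ₐ[K] QWeyl q := (exists_algHom_eq_evalTheta q).choose

lemma evalHom_apply (f : MvPolynomial (Fin n) K) : evalHom q f = evalTheta q f :=
  (exists_algHom_eq_evalTheta q).choose_spec.1 f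

@[simp]
lemma evalHom_X (i : Fin n) : evalHom q (MvPolynomial.X i) = theta q i :=
  (exists_algHom_eq_evalTheta q).choose_spec.2 i

lemma evalHom_mul_comm (f g : MvPolynomial (Fin n) K) :
    evalHom q f * evalHom q g = evalHom q g * evalHom q f := by
  rw [← map_mul, mul_comm, map_mul]

lemma evalHom_mul_x (f : MvPolynomial (Fin n) K) (i : Fin n) :
    evalHom q f * x q i = x q i * evalHom q (shiftX q i f) := by
  induction f using MvPolynomial.induction_on with
  | C a =>
    rw [← MvPolynomial.algebraMap_eq, AlgHom.commutes, AlgHom.commutes, AlgHom.commutes,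
      Algebra.commutes]
  | add f g hf hg => rw [map_add, add_mul, hf, hg, map_add, map_add, mul_add]
  | mul_X f j hf =>
    have hj : theta q j * x q i = x q i * evalHom q (shiftX q i (MvPolynomial.X j)) := by
      rcases eq_or_ne j i with rfl | h
      · rw [shiftX_X_self, theta_mul_x_self, map_add, map_mul, ← MvPolynomial.algebraMap_eq,
          AlgHom.commutes, map_one, evalHom_X, Algebra.smul_def]
      · rw [shiftX_X_of_ne q h, evalHom_X, theta_mul_x_of_ne q h]
    rw [map_mul, mul_assoc, evalHom_X, hj, ← mul_assoc, hf, mul_assoc, ← map_mul, ← map_mul]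

lemma evalHom_mul_d (f : MvPolynomial (Fin n) K) (i : Fin n) :
    evalHom q f * d q i = d q i * evalHom q (shiftD q i f) := by
  induction f using MvPolynomial.induction_on with
  | C a =>
    rw [← MvPolynomial.algebraMap_eq, AlgHom.commutes, AlgHom.commutes, AlgHom.commutes,
      Algebra.commutes]
  | add f g hf hg => rw [map_add, add_mul, hf, hg, map_add, map_add, mul_add]
  | mul_X f j hf =>
    have hj : theta q j * d q i = d q i * evalHom q (shiftD q i (MvPolynomial.X j)) := by
      rcases eq_or_ne j i with rfl | h
      · rw [shiftD_X_self, theta_mul_d_self, map_mul, map_sub, ← MvPolynomial.algebraMap_eq,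
          AlgHom.commutes, map_one, evalHom_X, Algebra.smul_def]
      · rw [shiftD_X_of_ne q h, evalHom_X, theta_mul_d_of_ne q h]
    rw [map_mul, mul_assoc, evalHom_X, hj, ← mul_assoc, hf, mul_assoc, ← map_mul, ← map_mul]

end EvalTheta

/-! ### The action of `ℤ^n` on `K[θ]`. -/

section Shift

/-- The substitution `θ_i ↦ (θ_i - 1) / q_i` as an automorphism of `K[θ]`. -/
def shiftEquiv (i : Fin n) : MvPolynomial (Fin n) K ≃ₐ[K] MvPolynomial (Fin n) K :=
  AlgEquiv.ofAlgHom (shiftD q i) (shiftX q i)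
    (MvPolynomial.algHom_ext fun j => by
      rw [AlgHom.comp_apply, AlgHom.id_apply]
      rcases eq_or_ne j i with rfl | h
      · rw [shiftX_X_self, map_add, map_mul, shiftD_C, shiftD_X_self, map_one, ← mul_assoc,
          C_mul_C_inv, one_mul, sub_add_cancel]
      · rw [shiftX_X_of_ne q h, shiftD_X_of_ne q h])
    (MvPolynomial.algHom_ext fun j => by
      rw [AlgHom.comp_apply, AlgHom.id_apply]
      rcases eq_or_ne j i with rfl | h
      · rw [shiftD_X_self, map_mul, map_sub, shiftX_C, shiftX_X_self, map_one, add_sub_cancel_right,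
          mul_left_comm, ← mul_assoc, C_mul_C_inv, one_mul]
      · rw [shiftD_X_of_ne q h, shiftX_X_of_ne q h])

@[simp]
lemma shiftEquiv_apply (i : Fin n) (f : MvPolynomial (Fin n) K) :
    shiftEquiv q i f = shiftD q i f := rfl

@[simp]
lemma shiftEquiv_symm_apply (i : Fin n) (f : MvPolynomial (Fin n) K) :
    (shiftEquiv q i).symm f = shiftX q i f := rfl

lemma shiftEquiv_commute (i j : Fin n) : Commute (shiftEquiv q i) (shiftEquiv q j) := by
  rcases eq_or_ne i j with rfl | hij
  · rfl
  refine AlgEquiv.coe_toAlgHom_injective (MvPolynomial.algHom_ext fun k => ?_)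
  change shiftD q i (shiftD q j (MvPolynomial.X k)) = shiftD q j (shiftD q i (MvPolynomial.X k))
  rcases eq_or_ne k i with rfl | hi
  · simp [shiftD_X_self, shiftD_X_of_ne q hij]
  · rcases eq_or_ne k j with rfl | hj
    · simp [shiftD_X_self, shiftD_X_of_ne q hi]
    · simp [shiftD_X_of_ne q hi, shiftD_X_of_ne q hj]

/-- The group `ℤ^n`, acting on `K[θ]` by the substitutions `θ_i ↦ (θ_i - 1) / q_i`. -/
def ShiftGroup (_ : Fin n → Kˣ) : Type := Fin n → Multiplicative ℤ

instance : CommGroup (ShiftGroup q) := inferInstanceAs (CommGroup (Fin n → Multiplicative ℤ))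

/-- This property of `ℤ^n` forces the factors of homogeneous elements to be homogeneous. -/
instance : TwoUniqueProds (ShiftGroup q) :=
  inferInstanceAs (TwoUniqueProds (Fin n → Multiplicative ℤ))

/-- The `i`-th standard generator of `ShiftGroup q`. -/
def gen (i : Fin n) : ShiftGroup q :=
  (Pi.mulSingle i (Multiplicative.ofAdd 1) : Fin n → Multiplicative ℤ)

/-- The action of `ℤ^n` on `K[θ]`. -/
def shiftHom : ShiftGroup q →* (MvPolynomial (Fin n) K ≃ₐ[K] MvPolynomial (Fin n) K) :=
  MonoidHom.noncommPiCoprod (fun i => zpowersHom _ (shiftEquiv q i))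
    fun i j _ _ _ => (shiftEquiv_commute q i j).zpow_zpow _ _

lemma shiftHom_gen (i : Fin n) : shiftHom q (gen q i) = shiftEquiv q i := by
  refine (MonoidHom.noncommPiCoprod_mulSingle _ i _).trans ?_
  simp

instance : MulSemiringAction (ShiftGroup q) (MvPolynomial (Fin n) K) :=
  MulSemiringAction.compHom _ (shiftHom q)

lemma shift_smul_def (g : ShiftGroup q) (f : MvPolynomial (Fin n) K) :
    g • f = shiftHom q g f := rfl

instance : SMulCommClass (ShiftGroup q) K (MvPolynomial (Fin n) K) :=
  ⟨fun g c f => map_smul (shiftHom q g) c f⟩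

lemma gen_smul (i : Fin n) (f : MvPolynomial (Fin n) K) : gen q i • f = shiftD q i f := by
  rw [shift_smul_def, shiftHom_gen, shiftEquiv_apply]

lemma gen_inv_smul (i : Fin n) (f : MvPolynomial (Fin n) K) :
    (gen q i)⁻¹ • f = shiftX q i f := by
  rw [shift_smul_def, map_inv, shiftHom_gen, ← shiftEquiv_symm_apply]
  rfl

lemma shift_smul_ne_zero (g : ShiftGroup q) {f : MvPolynomial (Fin n) K} (hf : f ≠ 0) :
    g • f ≠ 0 := by
  rwa [shift_smul_def, Ne, map_eq_zero_iff _ (shiftHom q g).injective]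

end Shift

/-! ### The skew group ring model of `Q_n`. -/

section Model

open MvPolynomial

/-- The skew group ring of `ℤ^n` over `K[θ]`, in which `Q_n` embeds. -/
abbrev SkewRing : Type _ := SkewMonoidAlgebra (MvPolynomial (Fin n) K) (ShiftGroup q)

/-- The images of the generators of `Q_n` in the skew group ring. -/
def toSkewGen : Fin n ⊕ Fin n → SkewRing q
  | Sum.inl i => SkewMonoidAlgebra.single (gen q i) 1
  -- `∂_i = x_i⁻¹ θ_i`; moving `θ_i` to the left of `x_i⁻¹` turns it into `q_i θ_i + 1`.
  | Sum.inr i => SkewMonoidAlgebra.single (gen q i)⁻¹ (shiftX q i (X i))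

/-- The embedding of `Q_n` in the skew group ring. -/
def toSkew : QWeyl q →ₐ[K] SkewRing q :=
  RingQuot.liftAlgHom K ⟨FreeAlgebra.lift K (toSkewGen q), fun a b h => by
    induction h with
    | x_x i j =>
      simp only [map_mul, FreeAlgebra.lift_ι_apply, toSkewGen, SkewMonoidAlgebra.single_mul_single,
        smul_one, mul_one, mul_comm]
    | d_d i j =>
      rcases eq_or_ne i j with rfl | h
      · rfl
      · simp only [map_mul, FreeAlgebra.lift_ι_apply, toSkewGen,
          SkewMonoidAlgebra.single_mul_single, gen_inv_smul]
        rw [shiftX_X_self, shiftX_X_self, map_add, map_mul, map_add, map_mul, shiftX_C, shiftX_C,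
          shiftX_X_of_ne q h, shiftX_X_of_ne q h.symm, map_one, map_one, mul_comm,
          mul_comm (_ + _ : MvPolynomial (Fin n) K)]
    | d_x_of_ne i j h =>
      simp only [map_mul, FreeAlgebra.lift_ι_apply, toSkewGen, SkewMonoidAlgebra.single_mul_single,
        smul_one, mul_one, one_mul, gen_smul]
      rw [shiftX_X_self, map_add, map_mul, shiftD_C, shiftD_X_of_ne q h, map_one, mul_comm]
    | d_x_self i =>
      simp only [map_mul, map_add, map_smul, map_one, FreeAlgebra.lift_ι_apply, toSkewGen,
        SkewMonoidAlgebra.single_mul_single, smul_one, mul_one, one_mul, gen_smul,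
        mul_inv_cancel, inv_mul_cancel]
      rw [← shiftEquiv_apply, ← shiftEquiv_symm_apply, AlgEquiv.apply_symm_apply,
        shiftEquiv_symm_apply, shiftX_X_self, SkewMonoidAlgebra.single_add,
        SkewMonoidAlgebra.one_def, SkewMonoidAlgebra.smul_single, MvPolynomial.smul_eq_C_mul]⟩

lemma toSkew_x (i : Fin n) : toSkew q (x q i) = SkewMonoidAlgebra.single (gen q i) 1 := by
  rw [toSkew, x, RingQuot.liftAlgHom_mkAlgHom_apply, FreeAlgebra.lift_ι_apply, toSkewGen]

lemma toSkew_d (i : Fin n) :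
    toSkew q (d q i) = SkewMonoidAlgebra.single (gen q i)⁻¹ (shiftX q i (X i)) := by
  rw [toSkew, d, RingQuot.liftAlgHom_mkAlgHom_apply, FreeAlgebra.lift_ι_apply, toSkewGen]

lemma toSkew_evalHom (f : MvPolynomial (Fin n) K) :
    toSkew q (evalHom q f) = SkewMonoidAlgebra.single 1 f := by
  induction f using MvPolynomial.induction_on with
  | C a =>
    rw [← MvPolynomial.algebraMap_eq, AlgHom.commutes, AlgHom.commutes]
    rfl
  | add f g hf hg => rw [map_add, map_add, hf, hg, SkewMonoidAlgebra.single_add]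
  | mul_X f j hf =>
    rw [map_mul, map_mul, hf, evalHom_X, theta, map_mul, toSkew_x, toSkew_d]
    simp only [SkewMonoidAlgebra.single_mul_single, one_mul, one_smul, gen_smul, mul_inv_cancel]
    rw [← shiftEquiv_apply, ← shiftEquiv_symm_apply, AlgEquiv.apply_symm_apply]

end Model

end QWeyl

instance {α β : Type*} [BEq α] [BEq β] [LawfulBEq α] [LawfulBEq β] : LawfulBEq (α ⊕ β) where
  eq_of_beq {a b} h := by
    rcases a with a | a <;> rcases b with b | b
    · exact congrArg _ (eq_of_beq (show (a == b) = true from h))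
    · exact absurd (show false = true from h) (by simp)
    · exact absurd (show false = true from h) (by simp)
    · exact congrArg _ (eq_of_beq (show (a == b) = true from h))
  rfl {a} := by
    rcases a with a | a
    · exact (show (a == a) = true from BEq.rfl)
    · exact (show (a == a) = true from BEq.rfl)

namespace QWeyl

variable {K : Type*} [Field K] {n : ℕ} (q : Fin n → Kˣ)

/-! ### Invariance and closure properties of derivations. -/

section Derivations

variable {q}

lemma Commutation.mul_eq {a b b' a' : QWeyl q} (h : Commutation q a b b' a') :
    a * b = b' * a' := by
  cases h with
  | theta_theta f g => simp only [← evalHom_apply, evalHom_mul_comm q f g]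
  | theta_x f i => simp only [← evalHom_apply, evalHom_mul_x]
  | theta_d f i => simp only [← evalHom_apply, evalHom_mul_d]
  | x_x i j => exact x_mul_x q i j
  | d_d i j => exact d_mul_d q i j
  | x_d i j h => exact (d_mul_x_of_ne q h.symm).symm

/-- Each operation encodes an identity in `Q_n`. This invariance later determines constants that a
derivation leaves untracked. -/
lemma Step.smul_prod_eq {F G : K × List (QWeyl q)} (h : Step q F G) :
    F.1 • F.2.prod = G.1 • G.2.prod := by
  cases h with
  | swap c u v a b b' a' h =>
    simp only [List.prod_append, List.prod_cons, List.prod_nil, mul_one, h.mul_eq]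
  | swap_symm c u v a b b' a' h =>
    simp only [List.prod_append, List.prod_cons, List.prod_nil, mul_one, h.mul_eq]
  | rewrite_theta c u v i =>
    simp only [List.prod_append, List.prod_cons, List.prod_nil, mul_one, theta]
  | rewrite_theta_add c u v i =>
    simp only [List.prod_append, List.prod_cons, List.prod_nil, mul_one, d_mul_x_eq,
      mul_smul_comm, smul_mul_assoc, smul_smul, mul_assoc, inv_mul_cancel₀ (q i).ne_zero]
  | renormalize c a ha u v f => simp [smul_smul]

lemma Derivable.smul_prod_eq {F G : K × List (QWeyl q)} (h : Derivable q F G) :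
    F.1 • F.2.prod = G.1 • G.2.prod := by
  induction h with
  | refl => rfl
  | tail _ h ih => exact ih.trans h.smul_prod_eq

lemma Derivable.refl (F : K × List (QWeyl q)) : Derivable q F F := Relation.ReflTransGen.refl

lemma Derivable.trans {F G H : K × List (QWeyl q)} (h : Derivable q F G) (h' : Derivable q G H) :
    Derivable q F H := Relation.ReflTransGen.trans h h'

lemma Step.derivable {F G : K × List (QWeyl q)} (h : Step q F G) : Derivable q F G :=
  Relation.ReflTransGen.single h

lemma Step.append {c c' : K} {A B : List (QWeyl q)} (h : Step q (c, A) (c', B))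
    (u v : List (QWeyl q)) : Step q (c, u ++ A ++ v) (c', u ++ B ++ v) := by
  cases h with
  | swap _ u' v' a b b' a' h => simpa using Step.swap c (u ++ u') (v' ++ v) a b b' a' h
  | swap_symm _ u' v' a b b' a' h => simpa using Step.swap_symm c (u ++ u') (v' ++ v) a b b' a' h
  | rewrite_theta _ u' v' i => simpa using Step.rewrite_theta c (u ++ u') (v' ++ v) i
  | rewrite_theta_add _ u' v' i => simpa using Step.rewrite_theta_add c (u ++ u') (v' ++ v) i
  | renormalize _ a ha u' v' f => simpa using Step.renormalize c' a ha (u ++ u') (v' ++ v) f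

lemma Derivable.append {c c' : K} {A B : List (QWeyl q)} (h : Derivable q (c, A) (c', B))
    (u v : List (QWeyl q)) : Derivable q (c, u ++ A ++ v) (c', u ++ B ++ v) :=
  Relation.ReflTransGen.lift (fun F : K × List (QWeyl q) => (F.1, u ++ F.2 ++ v))
    (fun _ _ h => Step.append h u v) _ _ h

lemma Derivable.append_left {c c' : K} {A B : List (QWeyl q)} (h : Derivable q (c, A) (c', B))
    (u : List (QWeyl q)) : Derivable q (c, u ++ A) (c', u ++ B) := by
  simpa using h.append u []

lemma Derivable.append_right {c c' : K} {A B : List (QWeyl q)} (h : Derivable q (c, A) (c', B))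
    (v : List (QWeyl q)) : Derivable q (c, A ++ v) (c', B ++ v) := by
  simpa using h.append [] v

lemma Derivable.cons {c c' : K} {A B : List (QWeyl q)} (h : Derivable q (c, A) (c', B))
    (f : QWeyl q) : Derivable q (c, f :: A) (c', f :: B) :=
  h.append_left [f]

lemma derivable_renormalize (c : K) {a : K} (ha : a ≠ 0) (f : QWeyl q) (v : List (QWeyl q)) :
    Derivable q (c * a, f :: v) (c, (a • f) :: v) :=
  (Step.renormalize c a ha [] v f).derivable

lemma Step.snd_ne_nil {F G : K × List (QWeyl q)} (h : Step q F G) : F.2 ≠ [] := by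
  cases h <;> simp

/-- Every operation acts on at least one factor, so the empty tuple is stuck. This is what shows
that letters are not invertible. -/
lemma Derivable.snd_eq_nil {c : K} {G : K × List (QWeyl q)} (h : Derivable q (c, []) G) :
    G.2 = [] := by
  rcases Relation.ReflTransGen.cases_head h with rfl | ⟨F, hF, _⟩
  · rfl
  · exact absurd rfl hF.snd_ne_nil

lemma derivable_of_commutation {a b b' a' : QWeyl q} (h : Commutation q a b b' a') (c : K) :
    Derivable q (c, [a, b]) (c, [b', a']) :=
  (Step.swap c [] [] a b b' a' h).derivable

lemma derivable_of_commutation_symm {a b b' a' : QWeyl q} (h : Commutation q a b b' a') (c : K) :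
    Derivable q (c, [b', a']) (c, [a, b]) :=
  (Step.swap_symm c [] [] a b b' a' h).derivable

/-- Adjacent transpositions suffice. Swaps are demanded only for members of `l`, so that `x_i` and
`∂_i` need not commute when they do not both occur. -/
lemma derivable_of_perm {α : Type*} (f : α → QWeyl q) (c : K) {l l' : List α} (h : l.Perm l')
    (hl : ∀ a ∈ l, ∀ b ∈ l, Derivable q (c, [f a, f b]) (c, [f b, f a])) :
    Derivable q (c, l.map f) (c, l'.map f) := by
  induction h with
  | nil => exact .refl _
  | cons a _ ih =>
    exact (ih fun a ha b hb => hl a (List.mem_cons_of_mem _ ha) b (List.mem_cons_of_mem _ hb)).cons _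
  | swap a b l => exact (hl b (by simp) a (by simp)).append_right (l.map f)
  | trans h₁ _ ih₁ ih₂ =>
    exact (ih₁ hl).trans (ih₂ fun a ha b hb => hl a (h₁.mem_iff.2 ha) b (h₁.mem_iff.2 hb))

lemma derivable_evalHom_swap (c : K) (f g : MvPolynomial (Fin n) K) :
    Derivable q (c, [evalHom q f, evalHom q g]) (c, [evalHom q g, evalHom q f]) := by
  simp only [evalHom_apply]
  exact derivable_of_commutation (.theta_theta f g) c

end Derivations

/-! ### The variables of `X^e D^w` and their permutations. -/

section Variables

/-- The generators `x_i` (for `Sum.inl i`) and `∂_i` (for `Sum.inr i`). -/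
def var : Fin n ⊕ Fin n → QWeyl q := Sum.elim (x q) (d q)

/-- The labels of the variables in `X^{e(z)} D^{w(z)}`. -/
def varsXD (z : Fin n → ℤ) : List (Fin n ⊕ Fin n) :=
  (List.ofFn fun i => List.replicate (-z i).toNat (Sum.inl i)).flatten ++
    (List.ofFn fun i => List.replicate (z i).toNat (Sum.inr i)).flatten

lemma map_var_varsXD (z : Fin n → ℤ) : (varsXD z).map (var q) = factorsXD q z := by
  simp [varsXD, factorsXD, List.map_flatten, List.map_ofFn, Function.comp_def, var]

lemma count_inl_varsXD (z : Fin n → ℤ) (i : Fin n) :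
    (varsXD z).count (Sum.inl i) = (-z i).toNat := by
  simp [varsXD, List.count_flatten, List.map_ofFn, Function.comp_def, List.sum_ofFn,
    List.count_replicate]

lemma count_inr_varsXD (z : Fin n → ℤ) (i : Fin n) :
    (varsXD z).count (Sum.inr i) = (z i).toNat := by
  simp [varsXD, List.count_flatten, List.map_ofFn, Function.comp_def, List.sum_ofFn,
    List.count_replicate]

/-- The only pairs of variables that do not swap are `x_i, ∂_i`; their absence makes the variables
of `X^e D^w` freely permutable. -/
lemma not_mem_varsXD (z : Fin n → ℤ) (i : Fin n) :
    ¬ (Sum.inl i ∈ varsXD z ∧ Sum.inr i ∈ varsXD z) := by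
  rw [← List.count_pos_iff, ← List.count_pos_iff, count_inl_varsXD, count_inr_varsXD]
  omega

lemma varsXD_zero : varsXD (0 : Fin n → ℤ) = [] := by
  simp [varsXD]

lemma varsXD_perm_x_of_nonpos {z : Fin n → ℤ} {i : Fin n} (h : z i ≤ 0) :
    (varsXD (z - Pi.single i 1)).Perm (Sum.inl i :: varsXD z) := by
  rw [List.perm_iff_count]
  rintro (j | j) <;> rcases eq_or_ne i j with rfl | hj <;>
    simp [count_inl_varsXD, count_inr_varsXD, *, Ne.symm] <;> omega

lemma varsXD_perm_d_of_nonneg {z : Fin n → ℤ} {i : Fin n} (h : 0 ≤ z i) :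
    (varsXD (z + Pi.single i 1)).Perm (Sum.inr i :: varsXD z) := by
  rw [List.perm_iff_count]
  rintro (j | j) <;> rcases eq_or_ne i j with rfl | hj <;>
    simp [count_inl_varsXD, count_inr_varsXD, *, Ne.symm] <;> omega

variable {q}

lemma derivable_var_swap (c : K) {v w : Fin n ⊕ Fin n} (h : w ≠ v.swap) :
    Derivable q (c, [var q v, var q w]) (c, [var q w, var q v]) := by
  rcases v with i | i <;> rcases w with j | j
  · exact derivable_of_commutation (.x_x i j) c
  · exact derivable_of_commutation (.x_d i j fun e => h (by simp [e])) c
  · exact derivable_of_commutation_symm (.x_d j i fun e => h (by simp [e])) c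
  · exact derivable_of_commutation (.d_d i j) c

lemma derivable_varsXD_of_perm (c : K) {z : Fin n → ℤ} {l : List (Fin n ⊕ Fin n)}
    (h : (varsXD z).Perm l) : Derivable q (c, (varsXD z).map (var q)) (c, l.map (var q)) := by
  refine derivable_of_perm _ c h fun v hv w hw => derivable_var_swap c ?_
  rintro rfl
  rcases v with i | i
  · exact not_mem_varsXD z i ⟨hv, hw⟩
  · exact not_mem_varsXD z i ⟨hw, hv⟩

lemma derivable_of_perm_varsXD (c : K) {z : Fin n → ℤ} {l : List (Fin n ⊕ Fin n)}
    (h : l.Perm (varsXD z)) : Derivable q (c, l.map (var q)) (c, (varsXD z).map (var q)) := by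
  refine derivable_of_perm _ c h fun v hv w hw => derivable_var_swap c ?_
  rw [h.mem_iff] at hv hw
  rintro rfl
  rcases v with i | i
  · exact not_mem_varsXD z i ⟨hv, hw⟩
  · exact not_mem_varsXD z i ⟨hw, hv⟩

end Variables

/-! ### Reaching tuples of letters from normal forms. -/

section NormalForm

open MvPolynomial

lemma irreducible_shiftD_iff (i : Fin n) {f : MvPolynomial (Fin n) K} :
    Irreducible (shiftD q i f) ↔ Irreducible f :=
  MulEquiv.irreducible_iff (shiftEquiv q i)

lemma irreducible_shiftX_iff (i : Fin n) {f : MvPolynomial (Fin n) K} :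
    Irreducible (shiftX q i f) ↔ Irreducible f :=
  MulEquiv.irreducible_iff (shiftEquiv q i).symm

lemma shiftX_shiftD (i : Fin n) (f : MvPolynomial (Fin n) K) :
    shiftX q i (shiftD q i f) = f :=
  (shiftEquiv q i).symm_apply_apply f

lemma shiftD_shiftX (i : Fin n) (f : MvPolynomial (Fin n) K) :
    shiftD q i (shiftX q i f) = f :=
  (shiftEquiv q i).apply_symm_apply f

/-- Up to the unit `q_i` this is the image of `θ_i` under the automorphism `θ_i ↦ q_i θ_i + 1`. -/
lemma irreducible_X_add_C (i : Fin n) :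
    Irreducible (X i + C (q i : K)⁻¹ : MvPolynomial (Fin n) K) := by
  have h : shiftX q i (X i) = C (q i : K) * (X i + C (q i : K)⁻¹) := by
    rw [shiftX_X_self, mul_add, C_mul_C_inv]
  have hu : IsUnit (C (q i : K) : MvPolynomial (Fin n) K) := (q i).isUnit.map C
  rw [← irreducible_isUnit_mul hu, ← h, irreducible_shiftX_iff]
  exact (X_prime).irreducible

lemma evalHom_X_add_C (i : Fin n) :
    evalHom q (X i + C (q i : K)⁻¹) = theta q i + algebraMap K (QWeyl q) (q i : K)⁻¹ := by
  rw [map_add, evalHom_X, ← MvPolynomial.algebraMap_eq, AlgHom.commutes]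

variable {q}

/-- A letter is a generator of `Q_n` or the value of an irreducible polynomial at `θ`. -/
def IsLetter (f : QWeyl q) : Prop :=
  (∃ g : MvPolynomial (Fin n) K, Irreducible g ∧ f = evalHom q g) ∨ ∃ v, f = var q v

/-- Passing a variable applies an automorphism of `K[θ]` to each polynomial, which preserves
irreducibility. -/
lemma exists_derivable_var_cons (c : K) (v : Fin n ⊕ Fin n) (P : List (MvPolynomial (Fin n) K))
    (hP : ∀ f ∈ P, Irreducible f) :
    ∃ P' : List (MvPolynomial (Fin n) K), (∀ f ∈ P', Irreducible f) ∧
      Derivable q (c, P'.map (evalHom q) ++ [var q v]) (c, var q v :: P.map (evalHom q)) := by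
  induction P with
  | nil => exact ⟨[], by simp, .refl _⟩
  | cons f P ih =>
    obtain ⟨P', hP', h⟩ := ih fun g hg => hP g (List.mem_cons_of_mem _ hg)
    have hf := hP f List.mem_cons_self
    obtain ⟨f', hf', h'⟩ : ∃ f', Irreducible f' ∧
        Derivable q (c, [evalHom q f', var q v]) (c, [var q v, evalHom q f]) := by
      simp only [evalHom_apply]
      rcases v with i | i
      · refine ⟨shiftD q i f, (irreducible_shiftD_iff q i).2 hf, ?_⟩
        have := derivable_of_commutation (.theta_x (q := q) (shiftD q i f) i) c
        rwa [shiftX_shiftD] at this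
      · refine ⟨shiftX q i f, (irreducible_shiftX_iff q i).2 hf, ?_⟩
        have := derivable_of_commutation (.theta_d (q := q) (shiftX q i f) i) c
        rwa [shiftD_shiftX] at this
    exact ⟨f' :: P', by simpa using ⟨hf', hP'⟩, (h.cons _).trans (h'.append_right _)⟩

lemma exists_derivable_var_varsXD {c : K} (hc : c ≠ 0) (v : Fin n ⊕ Fin n) (z : Fin n → ℤ) :
    ∃ (c' : K) (P : List (MvPolynomial (Fin n) K)) (z' : Fin n → ℤ), c' ≠ 0 ∧
      (∀ f ∈ P, Irreducible f) ∧
      Derivable q (c', P.map (evalHom q) ++ (varsXD z').map (var q))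
        (c, var q v :: (varsXD z).map (var q)) := by
  rcases v with i | i
  · rcases le_or_gt (z i) 0 with h | h
    · exact ⟨c, [], _, hc, by simp, derivable_varsXD_of_perm c (varsXD_perm_x_of_nonpos h)⟩
    -- Here `X^e D^w` contains a `∂_i`. Placed next to the new `x_i`, it comes from splitting a
    -- factor `θ_i`.
    · have hp := varsXD_perm_d_of_nonneg (z := z - Pi.single i 1) (i := i) (by simp; omega)
      rw [sub_add_cancel] at hp
      refine ⟨c, [X i], z - Pi.single i 1, hc, by simpa using X_prime.irreducible, ?_⟩
      refine Derivable.trans ?_ ((derivable_of_perm_varsXD c hp.symm).cons _)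
      simpa [var] using
        (Step.rewrite_theta c [] ((varsXD (z - Pi.single i 1)).map (var q)) i).derivable
  · rcases le_or_gt 0 (z i) with h | h
    · exact ⟨c, [], _, hc, by simp, derivable_varsXD_of_perm c (varsXD_perm_d_of_nonneg h)⟩
    · have hp := varsXD_perm_x_of_nonpos (z := z + Pi.single i 1) (i := i) (by simp; omega)
      rw [add_sub_cancel_right] at hp
      -- Splitting `θ_i + 1/q_i` divides the constant by `q_i`, hence the start at `c * q_i`.
      refine ⟨c * q i, [X i + C (q i : K)⁻¹], z + Pi.single i 1, mul_ne_zero hc (q i).ne_zero,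
        by simpa using irreducible_X_add_C q i, ?_⟩
      refine Derivable.trans ?_ ((derivable_of_perm_varsXD c hp.symm).cons _)
      have := (Step.rewrite_theta_add (c * q i) []
        ((varsXD (z + Pi.single i 1)).map (var q)) i).derivable
      rwa [mul_inv_cancel_right₀ (q i).ne_zero, ← evalHom_X_add_C] at this

/-- Every tuple of letters is derivable from one of the form `P(θ) X^{e(z)} D^{w(z)}`. -/
lemma exists_derivable_normalForm {c : K} (hc : c ≠ 0) (L : List (QWeyl q))
    (hL : ∀ f ∈ L, IsLetter f) :
    ∃ (c' : K) (P : List (MvPolynomial (Fin n) K)) (z : Fin n → ℤ), c' ≠ 0 ∧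
      (∀ f ∈ P, Irreducible f) ∧
      Derivable q (c', P.map (evalHom q) ++ (varsXD z).map (var q)) (c, L) := by
  induction L with
  | nil => exact ⟨c, [], 0, hc, by simp, by simpa [varsXD_zero] using Derivable.refl _⟩
  | cons f L ih =>
    obtain ⟨c₁, P, z, hc₁, hP, h⟩ := ih fun g hg => hL g (List.mem_cons_of_mem _ hg)
    rcases hL f List.mem_cons_self with ⟨g, hg, rfl⟩ | ⟨v, rfl⟩
    · exact ⟨c₁, g :: P, z, hc₁, by simpa using ⟨hg, hP⟩, h.cons _⟩
    · obtain ⟨P', hP', h'⟩ := exists_derivable_var_cons (q := q) c₁ v P hP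
      obtain ⟨c₂, P₂, z₂, hc₂, hP₂, h₂⟩ := exists_derivable_var_varsXD (q := q) hc₁ v z
      refine ⟨c₂, P' ++ P₂, z₂, hc₂, ?_, ?_⟩
      · intro g hg
        exact (List.mem_append.1 hg).elim (hP' g) (hP₂ g)
      · have := (h₂.append_left (P'.map (evalHom q))).trans (by
          simpa using (h'.append_right ((varsXD z).map (var q))).trans (h.cons _))
        simpa using this

end NormalForm

/-! ### Degrees and uniqueness of normal forms. -/

section Degrees

open SkewMonoidAlgebra

/-- The element of the group `ℤ^n` that corresponds to the degree `z`. -/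
def degree (z : Fin n → ℤ) : ShiftGroup q :=
  -- The sign is needed because `x_i` lowers `z_i` by one but maps to the positive generator.
  (fun i => Multiplicative.ofAdd (-z i) : Fin n → Multiplicative ℤ)

lemma degree_injective : Function.Injective (degree q) := by
  intro z z' h
  funext i
  exact neg_injective (Multiplicative.ofAdd.injective (congrFun h i))

lemma degree_surjective : Function.Surjective (degree q) := fun g =>
  ⟨fun i => -Multiplicative.toAdd ((show Fin n → Multiplicative ℤ from g) i), by
    funext i
    simp [degree]⟩

lemma degree_zero : degree q 0 = 1 := by
  funext i
  simp [degree]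
  rfl

lemma degree_add (z z' : Fin n → ℤ) : degree q (z + z') = degree q z * degree q z' := by
  funext i
  change Multiplicative.ofAdd (-(z i + z' i)) =
    Multiplicative.ofAdd (-z i) * Multiplicative.ofAdd (-z' i)
  rw [neg_add, ofAdd_add]

lemma degree_neg_single (i : Fin n) : degree q (-Pi.single i 1) = gen q i := by
  funext j
  rcases eq_or_ne j i with rfl | h
  · simp [degree, gen]
  · simp [degree, gen, h]

lemma degree_single (i : Fin n) : degree q (Pi.single i 1) = (gen q i)⁻¹ := by
  rw [eq_inv_iff_mul_eq_one, ← degree_neg_single, ← degree_add, add_neg_cancel, degree_zero]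

/-- Generators map to monomials, and coefficients stay nonzero because `ℤ^n` acts by automorphisms
on a domain. -/
lemma exists_toSkew_prod_map_var (l : List (Fin n ⊕ Fin n)) :
    ∃ r : MvPolynomial (Fin n) K, r ≠ 0 ∧ toSkew q (l.map (var q)).prod =
      single (degree q fun i => (l.count (Sum.inr i) : ℤ) - l.count (Sum.inl i)) r := by
  induction l with
  | nil =>
    refine ⟨1, one_ne_zero, ?_⟩
    rw [List.map_nil, List.prod_nil, map_one, one_def, ← degree_zero]
    congr 2
  | cons v l ih =>
    obtain ⟨r, hr, h⟩ := ih
    rw [List.map_cons, List.prod_cons, map_mul, h]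
    rcases v with i | i
    · refine ⟨gen q i • r, shift_smul_ne_zero q _ hr, ?_⟩
      rw [var, Sum.elim_inl, toSkew_x, single_mul_single, one_mul, ← degree_neg_single,
        ← degree_add]
      congr 2
      funext j
      rcases eq_or_ne i j with rfl | hj
      · simp
        ring
      · simp [hj, hj.symm]
    · refine ⟨shiftX q i (.X i) * (gen q i)⁻¹ • r, mul_ne_zero ?_ (shift_smul_ne_zero q _ hr), ?_⟩
      · exact ((irreducible_shiftX_iff q i).2 MvPolynomial.X_prime.irreducible).ne_zero
      · rw [var, Sum.elim_inr, toSkew_d, single_mul_single, ← degree_single, ← degree_add]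
        congr 2
        funext j
        rcases eq_or_ne i j with rfl | hj
        · simp
          ring
        · simp [hj, hj.symm]

lemma exists_toSkew_prod_varsXD (z : Fin n → ℤ) :
    ∃ r : MvPolynomial (Fin n) K, r ≠ 0 ∧
      toSkew q ((varsXD z).map (var q)).prod = single (degree q z) r := by
  obtain ⟨r, hr, h⟩ := exists_toSkew_prod_map_var q (varsXD z)
  refine ⟨r, hr, h.trans ?_⟩
  congr 2
  funext i
  rw [count_inl_varsXD, count_inr_varsXD]
  omega

/-- The monomial `X^{e(z)} D^{w(z)}`. -/
def monXD (z : Fin n → ℤ) : QWeyl q := ((varsXD z).map (var q)).prod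

/-- The coefficient of `X^{e(z)} D^{w(z)}` in the skew group ring. -/
def coeffXD (z : Fin n → ℤ) : MvPolynomial (Fin n) K := (exists_toSkew_prod_varsXD q z).choose

lemma coeffXD_ne_zero (z : Fin n → ℤ) : coeffXD q z ≠ 0 :=
  (exists_toSkew_prod_varsXD q z).choose_spec.1

lemma toSkew_evalHom_mul_monXD (f : MvPolynomial (Fin n) K) (z : Fin n → ℤ) :
    toSkew q (evalHom q f * monXD q z) = single (degree q z) (f * coeffXD q z) := by
  have h : toSkew q (monXD q z) = single (degree q z) (coeffXD q z) :=
    (exists_toSkew_prod_varsXD q z).choose_spec.2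
  rw [map_mul, toSkew_evalHom, h, single_mul_single, one_mul, one_smul]

lemma prod_normalForm (P : List (MvPolynomial (Fin n) K)) (z : Fin n → ℤ) :
    (P.map (evalHom q) ++ (varsXD z).map (var q)).prod = evalHom q P.prod * monXD q z := by
  rw [List.prod_append, monXD, map_list_prod]

variable {q} in
-- The support of the image in the skew group ring shows the degree, and cancelling `coeffXD` in the
-- domain `K[θ]` recovers the polynomial.
lemma evalHom_mul_monXD_inj {f g : MvPolynomial (Fin n) K} {z z' : Fin n → ℤ} (hf : f ≠ 0)
    (h : evalHom q f * monXD q z = evalHom q g * monXD q z') : z = z' ∧ f = g := by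
  have h' := congrArg (toSkew q) h
  rw [toSkew_evalHom_mul_monXD, toSkew_evalHom_mul_monXD] at h'
  have hne := mul_ne_zero hf (coeffXD_ne_zero q z)
  have hz : z = z' := by
    by_contra hzz
    have := congrArg (fun a => a.coeff (degree q z)) h'
    simp only [coeff_single, Finsupp.single_eq_same] at this
    rw [Finsupp.single_eq_of_ne (fun e => hzz (degree_injective q e))] at this
    exact hne this
  subst hz
  exact ⟨rfl, mul_right_cancel₀ (coeffXD_ne_zero q z) (single_injective _ h')⟩

end Degrees

/-! ### Normal forms with equal values. -/

section Uniqueness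

open MvPolynomial

variable {q}

lemma exists_smul_eq_of_associated {f g : MvPolynomial (Fin n) K} (h : Associated f g) :
    ∃ a : K, a ≠ 0 ∧ a • f = g := by
  obtain ⟨u, rfl⟩ := h
  obtain ⟨a, ha, hu⟩ := MvPolynomial.isUnit_iff_eq_C_of_isReduced.1 u.isUnit
  exact ⟨a, ha.ne_zero, by rw [hu, mul_comm, MvPolynomial.smul_eq_C_mul]⟩

/-- Swaps realize the permutation of the factors and renormalizations realize the units, which are
nonzero constants. -/
lemma exists_derivable_of_rel_associated (P P' : List (MvPolynomial (Fin n) K))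
    (h : Multiset.Rel Associated (P : Multiset (MvPolynomial (Fin n) K)) P') (c : K) :
    ∃ c', Derivable q (c, P.map (evalHom q)) (c', P'.map (evalHom q)) := by
  induction P generalizing P' c with
  | nil =>
    rw [Multiset.coe_nil, Multiset.rel_zero_left, Multiset.coe_eq_zero] at h
    exact ⟨c, by rw [h]; exact .refl _⟩
  | cons f P ih =>
    rw [← Multiset.cons_coe, Multiset.rel_cons_left] at h
    obtain ⟨g, s, hfg, hs, hP'⟩ := h
    obtain ⟨l, rfl⟩ := Quot.exists_rep s
    obtain ⟨a, ha, rfl⟩ := exists_smul_eq_of_associated hfg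
    obtain ⟨c', h'⟩ := ih l hs c
    have hperm : (a • f :: l).Perm P' := (Multiset.coe_eq_coe.1 hP').symm
    refine ⟨c' * a⁻¹, (h'.cons _).trans (.trans ?_ (derivable_of_perm (evalHom q) _ hperm
      fun f _ g _ => derivable_evalHom_swap _ f g))⟩
    have := derivable_renormalize (q := q) (c' * a⁻¹) ha (evalHom q f) (l.map (evalHom q))
    rwa [inv_mul_cancel_right₀ ha, ← map_smul] at this

/-- A tuple of letters is derivable from any tuple in normal form with the same value. -/
lemma derivable_of_smul_prod_eq {P : List (MvPolynomial (Fin n) K)}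
    (hP : ∀ f ∈ P, Irreducible f) {c c' : K} (hc : c ≠ 0) (hc' : c' ≠ 0) {z : Fin n → ℤ}
    {L : List (QWeyl q)} (hL : ∀ f ∈ L, IsLetter f)
    (h : c • (P.map (evalHom q) ++ (varsXD z).map (var q)).prod = c' • L.prod) :
    Derivable q (c, P.map (evalHom q) ++ (varsXD z).map (var q)) (c', L) := by
  have prod_ne_zero : ∀ {P : List (MvPolynomial (Fin n) K)}, (∀ f ∈ P, Irreducible f) →
      P.prod ≠ 0 := fun hP => List.prod_ne_zero fun h0 => (hP 0 h0).ne_zero rfl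
  obtain ⟨c₁, P₁, z₁, hc₁, hP₁, h₁⟩ := exists_derivable_normalForm hc' L hL
  have heq := h.trans h₁.smul_prod_eq.symm
  simp only [prod_normalForm, ← smul_mul_assoc, ← map_smul] at heq
  obtain ⟨rfl, heq'⟩ := evalHom_mul_monXD_inj (smul_ne_zero hc (prod_ne_zero hP)) heq
  have hass : Associated P.prod P₁.prod := by
    have hu : ∀ {a : K}, a ≠ 0 → IsUnit (C a : MvPolynomial (Fin n) K) := fun ha =>
      ha.isUnit.map C
    rw [MvPolynomial.smul_eq_C_mul, MvPolynomial.smul_eq_C_mul] at heq'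
    exact (associated_unit_mul_right P.prod _ (hu hc)).trans
      (heq' ▸ (associated_unit_mul_right P₁.prod _ (hu hc₁)).symm)
  obtain ⟨c₂, h₂⟩ := exists_derivable_of_rel_associated (q := q) P P₁
    (UniqueFactorizationMonoid.factors_unique (by simpa using hP) (by simpa using hP₁)
      (by simpa using hass)) c
  have h₂' := h₂.append_right ((varsXD z).map (var q))
  -- The matching of factors does not track its constant; equality of values forces it.
  have hcc : c₂ = c₁ := by
    have := h₂'.smul_prod_eq.symm
    simp only [prod_normalForm, ← smul_mul_assoc, ← map_smul] at this
    rw [heq] at this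
    have h3 := (evalHom_mul_monXD_inj (q := q) (smul_ne_zero hc₁ (prod_ne_zero hP₁)) this.symm).2
    exact (smul_left_injective K (prod_ne_zero hP₁) h3).symm
  exact h₂'.trans (hcc ▸ h₁)

end Uniqueness

/-! ### Factors of homogeneous elements. -/

section Homogeneous

open SkewMonoidAlgebra

variable {q}

/-- A nonzero element of `Q_n` is homogeneous if its image in the skew group ring is a monomial. -/
def IsHomog (f : QWeyl q) : Prop :=
  ∃ (g : ShiftGroup q) (r : MvPolynomial (Fin n) K), r ≠ 0 ∧ toSkew q f = single g r

/-- Only one pair of support elements contributes to a uniquely represented product, so nothing can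
cancel. -/
lemma coeff_mul_of_uniqueMul (a b : SkewRing q) {g h : ShiftGroup q}
    (hu : UniqueMul a.support b.support g h) (hg : g ∈ a.support) (hh : h ∈ b.support) :
    (a * b).coeff (g * h) = a.coeff g * g • b.coeff h := by
  classical
  rw [coeff_mul, sum_def', Finset.sum_eq_single_of_mem g hg, sum_def',
    Finset.sum_eq_single_of_mem h hh, if_pos rfl]
  · intro h' hh' hne
    rw [if_neg fun e => hne (hu hg hh' e).2]
  · intro g' hg' hne
    rw [sum_def']
    exact Finset.sum_eq_zero fun h' hh' => if_neg fun e => hne (hu hg' hh' e).1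

/-- If the supports were not both singletons, two uniquely represented products would give two
nonzero coefficients of a monomial. -/
lemma exists_single_of_mul_eq_single {a b : SkewRing q} {g : ShiftGroup q}
    {r : MvPolynomial (Fin n) K} (hr : r ≠ 0) (h : a * b = single g r) :
    (∃ g r, r ≠ 0 ∧ a = single g r) ∧ ∃ g r, r ≠ 0 ∧ b = single g r := by
  have hmem : ∀ p ∈ a.support ×ˢ b.support, UniqueMul a.support b.support p.1 p.2 →
      p.1 * p.2 = g := by
    rintro ⟨g₁, g₂⟩ hp hu
    rw [Finset.mem_product] at hp
    by_contra hne
    have := coeff_mul_of_uniqueMul a b hu hp.1 hp.2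
    rw [h, coeff_single, Finsupp.single_eq_of_ne hne] at this
    exact mul_ne_zero (mem_support_iff.1 hp.1)
      (shift_smul_ne_zero q _ (mem_support_iff.1 hp.2)) this.symm
  have hab : a * b ≠ 0 := by rwa [h, Ne, single_eq_zero]
  have ha : a.support.card ≠ 0 := by
    rw [Ne, Finset.card_eq_zero, support_eq_empty]
    exact left_ne_zero_of_mul hab
  have hb : b.support.card ≠ 0 := by
    rw [Ne, Finset.card_eq_zero, support_eq_empty]
    exact right_ne_zero_of_mul hab
  have hcard : a.support.card * b.support.card = 1 := by
    by_contra hne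
    obtain ⟨p₁, hp₁, p₂, hp₂, hpp, hu₁, hu₂⟩ :=
      TwoUniqueProds.uniqueMul_of_one_lt_card (A := a.support) (B := b.support) (by
        have := mul_ne_zero ha hb
        omega)
    have hp₂' := Finset.mem_product.1 hp₂
    obtain ⟨e₁, e₂⟩ := hu₁ hp₂'.1 hp₂'.2 ((hmem p₂ hp₂ hu₂).trans (hmem p₁ hp₁ hu₁).symm)
    exact hpp (Prod.ext e₁.symm e₂.symm)
  have key : ∀ a : SkewRing q, a.support.card = 1 → ∃ g r, r ≠ 0 ∧ a = single g r := by
    intro a ha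
    obtain ⟨g, r, hr, h⟩ := Finsupp.card_support_eq_one'.1 ha
    exact ⟨g, r, hr, coeff_injective (by rw [h, coeff_single])⟩
  exact ⟨key a (Nat.eq_one_of_mul_eq_one_right hcard), key b (Nat.eq_one_of_mul_eq_one_left hcard)⟩

lemma IsHomog.of_mul {f g : QWeyl q} (h : IsHomog (f * g)) : IsHomog f ∧ IsHomog g := by
  obtain ⟨a, r, hr, h⟩ := h
  rw [map_mul] at h
  exact exists_single_of_mul_eq_single hr h

lemma isHomog_one : IsHomog (1 : QWeyl q) :=
  ⟨1, 1, one_ne_zero, by rw [map_one, one_def]⟩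

lemma IsHomog.of_list_prod {l : List (QWeyl q)} (h : IsHomog l.prod) : ∀ f ∈ l, IsHomog f := by
  induction l with
  | nil => simp
  | cons f l ih =>
    rw [List.prod_cons] at h
    simpa using ⟨h.of_mul.1, ih h.of_mul.2⟩

variable (q) in
/-- The linear map `(g_z)_z ↦ ∑ g_z(θ) X^{e(z)} D^{w(z)}`. -/
def sumXD : ((Fin n → ℤ) →₀ MvPolynomial (Fin n) K) →ₗ[K] QWeyl q :=
  Finsupp.lsum K fun z => LinearMap.mulRight K (monXD q z) ∘ₗ (evalHom q).toLinearMap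

lemma prod_map_var_mem_range (l : List (Fin n ⊕ Fin n)) :
    (l.map (var q)).prod ∈ LinearMap.range (sumXD q) := by
  obtain ⟨c, P, z, -, -, h⟩ := exists_derivable_normalForm (q := q) one_ne_zero (l.map (var q))
    (by rintro _ hf; obtain ⟨v, -, rfl⟩ := List.mem_map.1 hf; exact .inr ⟨v, rfl⟩)
  have := h.smul_prod_eq
  rw [one_smul] at this
  refine ⟨Finsupp.single z (c • P.prod), ?_⟩
  rw [← this, prod_normalForm, sumXD, Finsupp.lsum_single, LinearMap.comp_apply,
    LinearMap.mulRight_apply, AlgHom.toLinearMap_apply, map_smul, smul_mul_assoc]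

/-- The span `W` of all words in the variables contains `1` and is stable under left multiplication
by generators, so it is everything; normal forms of words do the rest. -/
lemma sumXD_surjective : Function.Surjective (sumXD q) := by
  let W : Submodule K (QWeyl q) := Submodule.span K (Set.range fun l : List (Fin n ⊕ Fin n) => (l.map (var q)).prod)
  have hvar : ∀ v, ∀ f ∈ W, var q v * f ∈ W := by
    intro v f hf
    induction hf using Submodule.span_induction with
    | mem f hf =>
      obtain ⟨l, rfl⟩ := hf
      exact Submodule.subset_span ⟨v :: l, by simp⟩
    | zero => simp
    | add f g _ _ hf hg => rw [mul_add]; exact W.add_mem hf hg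
    | smul a f _ hf => rw [mul_smul_comm]; exact W.smul_mem a hf
  have hW : ∀ a : FreeAlgebra K (Fin n ⊕ Fin n), ∀ f ∈ W,
      RingQuot.mkAlgHom K (QWeylRel q) a * f ∈ W := by
    intro a
    induction a using FreeAlgebra.induction with
    | grade0 r =>
      intro f hf
      rw [AlgHom.commutes, ← Algebra.smul_def]
      exact W.smul_mem r hf
    | grade1 v =>
      rcases v with i | i
      · exact hvar (Sum.inl i)
      · exact hvar (Sum.inr i)
    | mul a b ha hb => intro f hf; rw [map_mul, mul_assoc]; exact ha _ (hb f hf)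
    | add a b ha hb =>
      intro f hf
      rw [map_add, add_mul]
      exact W.add_mem (ha f hf) (hb f hf)
  intro f
  obtain ⟨a, rfl⟩ := RingQuot.mkAlgHom_surjective K (QWeylRel q) f
  have h1 := hW a 1 (Submodule.subset_span ⟨[], rfl⟩)
  rw [mul_one] at h1
  have hle : W ≤ LinearMap.range (sumXD q) :=
    Submodule.span_le.2 (by rintro _ ⟨l, rfl⟩; exact prod_map_var_mem_range l)
  exact hle h1

lemma coeff_toSkew_sumXD (G : (Fin n → ℤ) →₀ MvPolynomial (Fin n) K) (z : Fin n → ℤ) :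
    (toSkew q (sumXD q G)).coeff (degree q z) = G z * coeffXD q z := by
  induction G using Finsupp.induction_linear with
  | zero => simp
  | add G H hG hH =>
    rw [map_add, map_add, coeff_add, Finsupp.add_apply, hG, hH, Finsupp.add_apply, add_mul]
  | single z' g =>
    rw [sumXD, Finsupp.lsum_single, LinearMap.comp_apply, LinearMap.mulRight_apply,
      AlgHom.toLinearMap_apply, toSkew_evalHom_mul_monXD, coeff_single]
    rcases eq_or_ne z z' with rfl | hz
    · rw [Finsupp.single_eq_same, Finsupp.single_eq_same]
    · rw [Finsupp.single_eq_of_ne hz, Finsupp.single_eq_of_ne ((degree_injective q).ne hz),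
        zero_mul]

/-- A homogeneous element is of the form `g(θ) X^{e(z)} D^{w(z)}`. -/
lemma IsHomog.exists_eq_evalHom_mul_monXD {f : QWeyl q} (hf : IsHomog f) :
    ∃ g z, g ≠ 0 ∧ f = evalHom q g * monXD q z := by
  obtain ⟨a, r, hr, h⟩ := hf
  obtain ⟨G, rfl⟩ := sumXD_surjective f
  obtain ⟨z, rfl⟩ := degree_surjective q a
  -- The image is supported in the single degree `z`, so each other `G z'` times the nonzero
  -- `coeffXD` vanishes.
  have hG : G = Finsupp.single z (G z) := by
    ext1 z'
    rcases eq_or_ne z' z with rfl | hz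
    · rw [Finsupp.single_eq_same]
    · rw [Finsupp.single_eq_of_ne hz]
      have := coeff_toSkew_sumXD (q := q) G z'
      rw [h, coeff_single, Finsupp.single_eq_of_ne ((degree_injective q).ne hz)] at this
      exact (mul_eq_zero.1 this.symm).resolve_right (coeffXD_ne_zero q z')
  refine ⟨G z, z, fun h0 => hr ?_, ?_⟩
  · have := coeff_toSkew_sumXD (q := q) G z
    rwa [h, coeff_single, Finsupp.single_eq_same, h0, zero_mul] at this
  · conv_lhs => rw [hG]
    rw [sumXD, Finsupp.lsum_single]
    rfl

lemma isLetter_of_mem_normalForm {P : List (MvPolynomial (Fin n) K)}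
    (hP : ∀ f ∈ P, Irreducible f) (z : Fin n → ℤ) :
    ∀ f ∈ P.map (evalHom q) ++ (varsXD z).map (var q), IsLetter f := by
  intro f hf
  rcases List.mem_append.1 hf with hf | hf
  · obtain ⟨g, hg, rfl⟩ := List.mem_map.1 hf
    exact .inl ⟨g, hP g hg, rfl⟩
  · obtain ⟨v, -, rfl⟩ := List.mem_map.1 hf
    exact .inr ⟨v, rfl⟩

lemma IsHomog.exists_eq_smul_prod {f : QWeyl q} (hf : IsHomog f) :
    ∃ (a : K) (L : List (QWeyl q)), a ≠ 0 ∧ (∀ g ∈ L, IsLetter g) ∧ f = a • L.prod := by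
  obtain ⟨g, z, hg, rfl⟩ := hf.exists_eq_evalHom_mul_monXD
  obtain ⟨s, hs, hsg⟩ := WfDvdMonoid.exists_factors g hg
  obtain ⟨P, rfl⟩ := Quot.exists_rep s
  obtain ⟨a, ha, rfl⟩ := exists_smul_eq_of_associated hsg
  refine ⟨a, _, ha, isLetter_of_mem_normalForm (P := P) (by simpa using hs) z, ?_⟩
  rw [prod_normalForm, map_smul, smul_mul_assoc]
  rfl

/-- A letter has no right inverse. -/
lemma IsLetter.mul_ne_one {f : QWeyl q} (hf : IsLetter f) (g : QWeyl q) : f * g ≠ 1 := by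
  intro h
  have hg : IsHomog g := (IsHomog.of_mul (f := f) (h ▸ isHomog_one)).2
  obtain ⟨a, L, ha, hL, rfl⟩ := hg.exists_eq_smul_prod
  -- The letters of `f * g` would multiply to `1`, the value of the empty normal form, and so be
  -- derivable from the empty tuple.
  have := derivable_of_smul_prod_eq (q := q) (P := []) (z := 0) (c := 1) (c' := a) (L := f :: L)
    (by simp) one_ne_zero ha (by simpa using ⟨hf, hL⟩) (by
      rw [varsXD_zero, List.prod_cons, ← mul_smul_comm, h]; simp)
  rw [varsXD_zero] at this
  exact absurd this.snd_eq_nil (by simp)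

end Homogeneous

/-! ### From factorizations to blocks of letters. -/

section Factorizations

variable {q}

/-- `B` is the letter tuple `L` of `f` with the constant `a` absorbed into its first letter, which
exists as `f` is not constant. With two or more letters, irreducibility would make a letter right
invertible. -/
lemma IsHomog.exists_block {f : QWeyl q} (hf : IsHomog f)
    (hc : f ∉ Set.range (algebraMap K (QWeyl q))) :
    ∃ (B L : List (QWeyl q)) (a : K), a ≠ 0 ∧ B.prod = f ∧ (Irreducible f → B = [f]) ∧
      (∀ g ∈ L, IsLetter g) ∧ ∀ c, Derivable q (c * a, L) (c, B) := by
  obtain ⟨a, L, ha, hL, rfl⟩ := hf.exists_eq_smul_prod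
  rcases L with - | ⟨g, L⟩
  · exact absurd ⟨a, by rw [List.prod_nil, Algebra.algebraMap_eq_smul_one]⟩ hc
  refine ⟨(a • g) :: L, g :: L, a, ha, by simp, fun hirr => ?_, hL,
    fun c => derivable_renormalize c ha g L⟩
  rcases L with - | ⟨g', L⟩
  · simp
  · rw [List.prod_cons, ← smul_mul_assoc] at hirr
    rcases hirr.isUnit_or_isUnit rfl with hu | hu
    · obtain ⟨b, hb⟩ := hu.exists_right_inv
      rw [smul_mul_assoc, ← mul_smul_comm] at hb
      exact absurd hb ((hL g (by simp)).mul_ne_one _)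
    · obtain ⟨b, hb⟩ := hu.exists_right_inv
      rw [List.prod_cons, mul_assoc] at hb
      exact absurd hb ((hL g' (by simp)).mul_ne_one _)

lemma exists_blocks (l : List (QWeyl q)) (hl : ∀ f ∈ l, IsHomog f)
    (hc : ∀ f ∈ l, f ∉ Set.range (algebraMap K (QWeyl q))) :
    ∃ (blocks : List (List (QWeyl q))) (L : List (QWeyl q)) (a : K), a ≠ 0 ∧
      blocks.map List.prod = l ∧ ((∀ f ∈ l, Irreducible f) → blocks.flatten = l) ∧
      (∀ g ∈ L, IsLetter g) ∧ ∀ c, Derivable q (c * a, L) (c, blocks.flatten) := by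
  induction l with
  | nil => exact ⟨[], [], 1, one_ne_zero, rfl, fun _ => rfl, by simp, fun c => by
      rw [mul_one]; exact .refl _⟩
  | cons f l ih =>
    obtain ⟨blocks, L, a, ha, hprod, hirr, hL, h⟩ :=
      ih (fun g hg => hl g (List.mem_cons_of_mem _ hg)) fun g hg => hc g (List.mem_cons_of_mem _ hg)
    obtain ⟨B, L', a', ha', hprod', hirr', hL', h'⟩ :=
      (hl f List.mem_cons_self).exists_block (hc f List.mem_cons_self)
    refine ⟨B :: blocks, L' ++ L, a * a', mul_ne_zero ha ha', by simp [hprod, hprod'],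
      fun hi => ?_, fun g hg => (List.mem_append.1 hg).elim (hL' g) (hL g), fun c => ?_⟩
    · rw [List.flatten_cons, hirr' (hi f List.mem_cons_self),
        hirr fun g hg => hi g (List.mem_cons_of_mem _ hg), List.singleton_append]
    · rw [List.flatten_cons, ← mul_assoc]
      exact ((h' (c * a)).append_right L).trans ((h c).append_left B)

/-- The factors of `T` as polynomials. -/
def polysT (t s : Fin n → ℕ) : List (MvPolynomial (Fin n) K) :=
  (List.ofFn fun i => List.replicate (t i) (MvPolynomial.X i) ++
    List.replicate (s i) (MvPolynomial.X i + MvPolynomial.C (q i : K)⁻¹)).flatten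

lemma map_evalHom_polysT (t s : Fin n → ℕ) :
    (polysT (q := q) t s).map (evalHom q) = factorsT q t s := by
  simp only [polysT, factorsT, List.map_flatten, List.map_ofFn, Function.comp_def, List.map_append,
    List.map_replicate, evalHom_X, evalHom_X_add_C]

lemma irreducible_of_mem_polysT (t s : Fin n → ℕ) :
    ∀ f ∈ polysT (q := q) t s, Irreducible f := by
  intro f hf
  obtain ⟨l, hl, hf⟩ := List.mem_flatten.1 hf
  obtain ⟨i, rfl⟩ := (List.mem_ofFn' _ _).1 hl
  rcases List.mem_append.1 hf with hf | hf
  · rw [List.eq_of_mem_replicate hf]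
    exact MvPolynomial.X_prime.irreducible
  · rw [List.eq_of_mem_replicate hf]
    exact irreducible_X_add_C q i

end Factorizations

end QWeyl

end

theorem mainTheorem3 {K : Type*} [Field K] [CharZero K] {n : ℕ} (q : Fin n → Kˣ)
    (z : Fin n → ℤ) (p : QWeyl q) (hp : p ∈ QWeyl.gradedPart q z)
    -- one factorization `p = c₀ • Q(θ) * T(θ) * X^e D^w` with `e = e(z)`, `w = w(z)`
    (c₀ : K) (hc₀ : c₀ ≠ 0) (Q : List (MvPolynomial (Fin n) K))
    (hQ : ∀ f ∈ Q, Irreducible f ∧ Irreducible (QWeyl.evalTheta q f))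
    (t s : Fin n → ℕ) (F₀ : K × List (QWeyl q))
    (hF₀ : F₀ = (c₀, Q.map (QWeyl.evalTheta q) ++ QWeyl.factorsT q t s ++ QWeyl.factorsXD q z))
    (hpF₀ : p = F₀.1 • F₀.2.prod) :
    -- every factorization into irreducible factors is derived from it
    (∀ F : K × List (QWeyl q), QWeyl.IsNontrivialFactorization q p F →
      (∀ f ∈ F.2, Irreducible f) → QWeyl.Derivable q F₀ F) ∧
    -- every factorization is derived from it, up to multiplying together adjacent factors
    (∀ F : K × List (QWeyl q), QWeyl.IsNontrivialFactorization q p F →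
      ∃ blocks : List (List (QWeyl q)), blocks.map List.prod = F.2 ∧
        QWeyl.Derivable q F₀ (F.1, blocks.flatten)) := by
  subst hF₀
  have hP : ∀ f ∈ Q ++ QWeyl.polysT (q := q) t s, Irreducible f := fun f hf =>
    (List.mem_append.1 hf).elim (fun h => (hQ f h).1) (QWeyl.irreducible_of_mem_polysT t s f)
  have hF : Q.map (QWeyl.evalTheta q) ++ QWeyl.factorsT q t s ++ QWeyl.factorsXD q z =
      (Q ++ QWeyl.polysT (q := q) t s).map (QWeyl.evalHom q) ++
        (QWeyl.varsXD z).map (QWeyl.var q) := by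
    rw [List.map_append, QWeyl.map_evalHom_polysT, QWeyl.map_var_varsXD,
      show QWeyl.evalTheta q = QWeyl.evalHom q from funext fun f => (QWeyl.evalHom_apply q f).symm]
  rw [hF] at hpF₀ ⊢
  -- Both claims follow from one refinement into blocks, which changes nothing when all factors are
  -- irreducible.
  have key : ∀ F : K × List (QWeyl q), QWeyl.IsNontrivialFactorization q p F →
      ∃ blocks : List (List (QWeyl q)), blocks.map List.prod = F.2 ∧
        ((∀ f ∈ F.2, Irreducible f) → blocks.flatten = F.2) ∧
        QWeyl.Derivable q (c₀, (Q ++ QWeyl.polysT (q := q) t s).map (QWeyl.evalHom q) ++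
          (QWeyl.varsXD z).map (QWeyl.var q)) (F.1, blocks.flatten) := by
    rintro ⟨c, l⟩ ⟨hc, hl, hp⟩
    -- Homogeneity of `p` is read off from `F₀`. Writing `c` as a factor lets `IsHomog.of_mul`
    -- remove it.
    have hhom : QWeyl.IsHomog (algebraMap K (QWeyl q) c * l.prod) := by
      refine ⟨QWeyl.degree q z, c₀ • (Q ++ QWeyl.polysT (q := q) t s).prod * QWeyl.coeffXD q z,
        mul_ne_zero (smul_ne_zero hc₀ (List.prod_ne_zero fun h => (hP 0 h).ne_zero rfl))
          (QWeyl.coeffXD_ne_zero q z), ?_⟩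
      rw [← Algebra.smul_def, ← hp, hpF₀, QWeyl.prod_normalForm, ← smul_mul_assoc, ← map_smul,
        QWeyl.toSkew_evalHom_mul_monXD]
    obtain ⟨blocks, L, a, ha, hprod, hirr, hL, h⟩ :=
      QWeyl.exists_blocks l hhom.of_mul.2.of_list_prod hl
    refine ⟨blocks, hprod, hirr, (QWeyl.derivable_of_smul_prod_eq hP hc₀ (mul_ne_zero hc ha) hL
      ?_).trans (h c)⟩
    have hval := (h c).smul_prod_eq
    rw [← hpF₀, hp, hval, List.prod_flatten, hprod]
  refine ⟨fun F hF hirr => ?_, fun F hF => ?_⟩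
  · obtain ⟨blocks, -, hb, h⟩ := key F hF
    rwa [hb hirr] at h
  · obtain ⟨blocks, hb, -, h⟩ := key F hF
    exact ⟨blocks, hb, h⟩
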